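/- Consider a qubit (system $S=\mathbb{C}^2$) coupled to a qubit environment ($E=\mathbb{C}^2$) that starts in the pure state $|1\rangle$. A unitary $U$ on $S\otimes E$ defines the channel $\Phi_U(\rho)=\mathrm{Tr}_E[U(\rho\otimes|1\rangle\langle 1|)U^\dagger]$ and its complementary channel $\tilde\Phi_U(\rho)=\mathrm{Tr}_S[U(\rho\otimes|1\rangle\langle 1|)U^\dagger]$. The entropy $S^{\mathrm{map}}(\Phi)$ of a channel $\Phi$ on $2\times 2$ matrices is the von Neumann entropy $S(\sigma_\Phi)=-\mathrm{Tr}\,\sigma_\Phi\log\sigma_\Phi$ (natural logarithm) of its Choi–Jamiołkowski state $\sigma_\Phi=(\mathbb{I}\otimes\Phi)(|\psi_+\rangle\langle\psi_+|)$, $|\psi_+\rangle=\frac{1}{\sqrt2}\sum_{i=1}^{2}|i\rangle\otimes|i\rangle$. Let $$\mathcal{A}_2=\{(S^{\mathrm{map}}(\Phi_U),S^{\mathrm{map}}(\tilde\Phi_U)) : U \text{ unitary on } \mathbb{C}^2\otimes\mathbb{C}^2\}\subset\mathbb{R}^2,$$ and let $h(p)=-p\log p-(1-p)\log(1-p)$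 (with $0\log 0=0$). Then the lower boundary of $\mathcal{A}_2$, i.e. the set of those points of $\mathcal{A}_2$ whose second coordinate is minimal among all points of $\mathcal{A}_2$ with the same first coordinate, is the parametric curve $$p(a)=\left(h(a),\,h(\tfrac12-a)\right),\qquad a\in[0,\tfrac12].$$ In detail: for every $a\in[0,\frac12]$ the minimum of $S^{\mathrm{map}}(\tilde\Phi_U)$ over all $U$ with $S^{\mathrm{map}}(\Phi_U)=h(a)$ exists and equals $h(\frac12-a)$; and every point $(s,\tilde s)\in\mathcal{A}_2$ satisfies $s=h(a)$ and $\tilde s\ge h(\frac12-a)$ for some $a\in[0,\frac12]$. Moreover, the curve is attained by amplitude-damping (spontaneous emission) channels: for every $a\in[0,\frac12]$ the channel $\rho\mapsto K_1\rho K_1^\dagger+K_2\rho K_2^\dagger$ with $$K_1=\begin{pmatrix}1&0\\0&\sqrt{x}\end{pmatrix},\quad K_2=\begin{pmatrix}0&\sqrt{1-x}\\0&0\end{pmatrix},\quad x=1-2a,$$ is of the form $\Phi_U$, and every unitary $U$ for which $\Phi_U$ is this channel satisfies $(S^{\mathrm{map}}(\Phi_U),S^{\mathrm{map}}(\tilde\Phi_U))=p(a)$.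 -/

import Mathlib

open scoped Matrix Kronecker

noncomputable section

namespace ChannelEntropy

/-- The von Neumann entropy `S(ρ) = -Tr (ρ log ρ)` (natural logarithm, `0 log 0 = 0`); the matrix
logarithm is taken by the functional calculus of Hermitian matrices. -/
def vonNeumannEntropy {n : Type*} [Fintype n] [DecidableEq n] (ρ : Matrix n n ℂ) : ℝ :=
  -((ρ * cfc Real.log ρ).trace).re

/-- Partial trace over the second tensor factor (the environment). -/
def traceEnv {s e : Type*} [Fintype e] : Matrix (s × e) (s × e) ℂ →ₗ[ℂ] Matrix s s ℂ where
  toFun X := Matrix.of fun i j => ∑ k, X (i, k) (j, k)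
  map_add' X Y := by
    ext i j
    simp [Finset.sum_add_distrib]
  map_smul' c X := by
    ext i j
    simp [Finset.mul_sum]

/-- Partial trace over the first tensor factor (the principal system). -/
def traceSys {s e : Type*} [Fintype s] : Matrix (s × e) (s × e) ℂ →ₗ[ℂ] Matrix e e ℂ where
  toFun X := Matrix.of fun k l => ∑ i, X (i, k) (i, l)
  map_add' X Y := by
    ext i j
    simp [Finset.sum_add_distrib]
  map_smul' c X := by
    ext i j
    simp [Finset.mul_sum]

/-- The joint evolution `ρ ↦ U (ρ ⊗ |e₀⟩⟨e₀|) U†` of a system and an environment that starts in the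
pure state `|e₀⟩`. -/
def jointEvolution {s e : Type*} [Fintype s] [DecidableEq s] [Fintype e] [DecidableEq e] (e₀ : e)
    (U : Matrix.unitaryGroup (s × e) ℂ) : Matrix s s ℂ →ₗ[ℂ] Matrix (s × e) (s × e) ℂ where
  toFun ρ := (U : Matrix (s × e) (s × e) ℂ) * (ρ ⊗ₖ Matrix.single e₀ e₀ (1 : ℂ)) *
    (U : Matrix (s × e) (s × e) ℂ)ᴴ
  map_add' X Y := by
    rw [Matrix.add_kronecker, Matrix.mul_add, Matrix.add_mul]
  map_smul' c X := by
    rw [Matrix.smul_kronecker, Matrix.mul_smul, Matrix.smul_mul, RingHom.id_apply]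

/-- The quantum channel `Φ(ρ) = Tr_E [U (ρ ⊗ |e₀⟩⟨e₀|) U†]`. -/
def channel {s e : Type*} [Fintype s] [DecidableEq s] [Fintype e] [DecidableEq e] (e₀ : e)
    (U : Matrix.unitaryGroup (s × e) ℂ) : Matrix s s ℂ →ₗ[ℂ] Matrix s s ℂ :=
  traceEnv ∘ₗ jointEvolution e₀ U

/-- The complementary channel `Φ̃(ρ) = Tr_S [U (ρ ⊗ |e₀⟩⟨e₀|) U†]`. -/
def complementaryChannel {s e : Type*} [Fintype s] [DecidableEq s] [Fintype e] [DecidableEq e]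
    (e₀ : e) (U : Matrix.unitaryGroup (s × e) ℂ) : Matrix s s ℂ →ₗ[ℂ] Matrix e e ℂ :=
  traceSys ∘ₗ jointEvolution e₀ U

/-- The Choi-Jamiołkowski state `σ_Φ = (𝟙 ⊗ Φ)(|ψ₊⟩⟨ψ₊|)`, `|ψ₊⟩ = N^(-1/2) ∑ i, |i⟩ ⊗ |i⟩`: the
block matrix whose `(i, j)` block is `Φ(|i⟩⟨j|) / N`. -/
def choiState {s t : Type*} [Fintype s] [DecidableEq s]
    (Φ : Matrix s s ℂ →ₗ[ℂ] Matrix t t ℂ) : Matrix (s × t) (s × t) ℂ :=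
  Matrix.of fun p q => (Fintype.card s : ℂ)⁻¹ * Φ (Matrix.single p.1 q.1 1) p.2 q.2

/-- The entropy of a map, `S^map(Φ) = S(σ_Φ)`. -/
def mapEntropy {s t : Type*} [Fintype s] [DecidableEq s] [Fintype t] [DecidableEq t]
    (Φ : Matrix s s ℂ →ₗ[ℂ] Matrix t t ℂ) : ℝ :=
  vonNeumannEntropy (choiState Φ)

/-- The allowed region `𝒜_N`: all pairs `(S^map(Φ), S^map(Φ̃))` for an `N`-dimensional system
coupled to an `N`-dimensional environment. -/
def allowedRegion (N : ℕ) [NeZero N] : Set (ℝ × ℝ) :=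
  Set.range fun U : Matrix.unitaryGroup (Fin N × Fin N) ℂ =>
    (mapEntropy (channel 0 U), mapEntropy (complementaryChannel 0 U))

/-- The lower boundary of a plane set: its points whose second coordinate is minimal among all points
of the set with the same first coordinate. -/
def lowerBoundary (A : Set (ℝ × ℝ)) : Set (ℝ × ℝ) :=
  {p | IsLeast {t : ℝ | (p.1, t) ∈ A} p.2}

/-- The map `ρ ↦ ∑ i, K i ρ (K i)†` with Kraus operators `K i`. -/
def krausMap {ι s t : Type*} [Fintype ι] [Fintype s] (K : ι → Matrix t s ℂ) :
    Matrix s s ℂ →ₗ[ℂ] Matrix t t ℂ where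
  toFun ρ := ∑ i, K i * ρ * (K i)ᴴ
  map_add' X Y := by
    simp [Matrix.mul_add, Matrix.add_mul, Finset.sum_add_distrib]
  map_smul' c X := by
    simp [Finset.smul_sum]

/-- The Kraus operators of the amplitude damping (spontaneous emission) channel of a qubit. -/
def amplitudeDampingKraus (x : ℝ) : Fin 2 → Matrix (Fin 2) (Fin 2) ℂ :=
  ![!![1, 0; 0, (Real.sqrt x : ℂ)], !![0, (Real.sqrt (1 - x) : ℂ); 0, 0]]

/-- The amplitude damping (spontaneous emission) channel of a qubit. -/
def amplitudeDamping (x : ℝ) : Matrix (Fin 2) (Fin 2) ℂ →ₗ[ℂ] Matrix (Fin 2) (Fin 2) ℂ :=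
  krausMap (amplitudeDampingKraus x)

end ChannelEntropy

end

open ChannelEntropy

/-! The nonzero spectrum of a Choi state is that of the Gram matrix of the Kraus operators
(`mapEntropy_krausMap`). For a channel and its complement these 2×2 Gram matrices are, up to
transpose, the reduced environment and system states when the input is maximally mixed. Local basis
changes diagonalise both, so their eigenvalues become the marginals of a 2×2 table of outcome
probabilities. The joint state is half a projection, so each entry is at most 1/2
(`exists_weights`).

Hence the smaller eigenvalues `a`, `b` of the two states satisfy `a + b ≥ 1/2`, and monotonicity of
`h` on `[0, 1/2]` gives the bound (`exists_curve_le`). Amplitude damping reaches `a + b = 1/2`, and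
injectivity of `h` there turns the bound into a minimum (`isLeast_curve`). -/

open scoped Matrix Kronecker

namespace ChannelEntropy

/-! ### Entropy and the nonzero spectrum -/

section Entropy

variable {m n : Type*} [Fintype m] [DecidableEq m] [Fintype n] [DecidableEq n]

/-- The functional calculus of a Hermitian matrix agrees with any polynomial interpolating the
function on the spectrum. -/
lemma cfc_eq_aeval {A : Matrix n n ℂ} (hA : A.IsHermitian) {f : ℝ → ℝ} {p : Polynomial ℝ}
    (h : ∀ x ∈ spectrum ℝ A, f x = p.eval x) : cfc f A = Polynomial.aeval A p :=
  (cfc_congr h).trans (cfc_polynomial p A hA)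

lemma aeval_mul_mul (A : Matrix m n ℂ) (B : Matrix n m ℂ) (p : Polynomial ℝ) :
    Polynomial.aeval (A * B) p * A = A * Polynomial.aeval (B * A) p := by
  induction p using Polynomial.induction_on' with
  | add p q hp hq => simp only [map_add, Matrix.add_mul, Matrix.mul_add, hp, hq]
  | monomial k c =>
    have key : (A * B) ^ k * A = A * (B * A) ^ k := by
      induction k with
      | zero => simp
      | succ k ih => rw [pow_succ, Matrix.mul_assoc, Matrix.mul_assoc, ← Matrix.mul_assoc,
          ih, Matrix.mul_assoc, ← pow_succ]
    simp only [Polynomial.aeval_monomial, Algebra.algebraMap_eq_smul_one, Matrix.smul_mul,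
      Matrix.mul_smul, one_mul, key]

/-- `A * B` and `B * A` differ only in zero eigenvalues, which carry no entropy. No spectral
comparison is needed: one polynomial replaces the logarithm on both spectra, and cyclicity of the
trace does the rest. -/
lemma vonNeumannEntropy_mul_comm (A : Matrix m n ℂ) (B : Matrix n m ℂ)
    (hAB : (A * B).IsHermitian) (hBA : (B * A).IsHermitian) :
    vonNeumannEntropy (A * B) = vonNeumannEntropy (B * A) := by
  classical
  obtain ⟨s, hs⟩ : ∃ s : Finset ℝ, (s : Set ℝ) = spectrum ℝ (A * B) ∪ spectrum ℝ (B * A) :=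
    (((A * B).finite_real_spectrum).union ((B * A).finite_real_spectrum)).exists_finset_coe
  set p := Lagrange.interpolate s id Real.log
  have hp : ∀ x ∈ s, Real.log x = p.eval x := fun x hx =>
    (Lagrange.eval_interpolate_at_node Real.log (Set.injOn_id _) hx).symm
  have h1 : ∀ x ∈ spectrum ℝ (A * B), Real.log x = p.eval x := fun x hx =>
    hp x (by rw [← Finset.mem_coe, hs]; exact Or.inl hx)
  have h2 : ∀ x ∈ spectrum ℝ (B * A), Real.log x = p.eval x := fun x hx =>
    hp x (by rw [← Finset.mem_coe, hs]; exact Or.inr hx)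
  rw [vonNeumannEntropy, vonNeumannEntropy, cfc_eq_aeval hAB h1, cfc_eq_aeval hBA h2,
    Matrix.mul_assoc, Matrix.trace_mul_comm, Matrix.mul_assoc, aeval_mul_mul, ← Matrix.mul_assoc]

lemma vonNeumannEntropy_eq_sum {A : Matrix n n ℂ} (hA : A.IsHermitian) :
    vonNeumannEntropy A = ∑ i, Real.negMulLog (hA.eigenvalues i) := by
  have h : A * cfc Real.log A = cfc (fun x => x * Real.log x) A := by
    have hA' : IsSelfAdjoint A := hA
    have hf : ContinuousOn Real.log (spectrum ℝ A) := A.finite_real_spectrum.continuousOn _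
    rw [cfc_mul (fun x => x) Real.log A continuousOn_id hf, cfc_id' ℝ A hA']
  rw [vonNeumannEntropy, h, hA.cfc_eq, Matrix.IsHermitian.cfc, Unitary.conjStarAlgAut_apply,
    Matrix.trace_mul_cycle, Unitary.coe_star_mul_self, one_mul, Matrix.trace_diagonal,
    Complex.re_sum, ← Finset.sum_neg_distrib]
  simp [Real.negMulLog]

end Entropy

/-! ### Entropy of 2×2 states -/

section Qubit

variable {A : Matrix (Fin 2) (Fin 2) ℂ}

lemma sum_eigenvalues_eq_one (hA : A.IsHermitian) (ht : A.trace = 1) :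
    hA.eigenvalues 0 + hA.eigenvalues 1 = 1 := by
  have h := hA.trace_eq_sum_eigenvalues
  rw [ht, Fin.sum_univ_two] at h
  simpa using (congrArg Complex.re h).symm

lemma vonNeumannEntropy_eq_binEntropy (hA : A.IsHermitian) (ht : A.trace = 1) :
    vonNeumannEntropy A = Real.binEntropy (hA.eigenvalues 0) := by
  rw [vonNeumannEntropy_eq_sum hA, Fin.sum_univ_two,
    Real.binEntropy_eq_negMulLog_add_negMulLog_one_sub, ← sum_eigenvalues_eq_one hA ht,
    add_sub_cancel_left]

lemma vonNeumannEntropy_eq_of_det {p : ℝ} (hA : A.IsHermitian) (ht : A.trace = 1)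
    (hd : A.det = p * (1 - p)) : vonNeumannEntropy A = Real.binEntropy p := by
  have hs := sum_eigenvalues_eq_one hA ht
  have hdet := hA.det_eq_prod_eigenvalues
  rw [hd, Fin.prod_univ_two] at hdet
  have hdet' : p * (1 - p) = hA.eigenvalues 0 * hA.eigenvalues 1 := by
    simpa [← Complex.ofReal_one, ← Complex.ofReal_sub] using congrArg Complex.re hdet
  rw [vonNeumannEntropy_eq_binEntropy hA ht]
  have : (hA.eigenvalues 0 - p) * (hA.eigenvalues 0 - (1 - p)) = 0 := by
    rw [← eq_sub_iff_add_eq'] at hs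
    rw [hs] at hdet'
    linear_combination hdet'
  rcases mul_eq_zero.mp this with h | h
  · rw [sub_eq_zero.mp h]
  · rw [sub_eq_zero.mp h, Real.binEntropy_one_sub]

end Qubit

/-! ### Map entropy from the Kraus Gram matrix -/

section Kraus

variable {ι s t : Type*} [Fintype ι] [DecidableEq ι] [Fintype s] [DecidableEq s] [Fintype t]
  [DecidableEq t]

/-- The normalised Gram matrix of a family of Kraus operators for the Hilbert-Schmidt product. -/
noncomputable def krausGram (K : ι → Matrix t s ℂ) : Matrix ι ι ℂ :=
  Matrix.of fun k l => (Fintype.card s : ℂ)⁻¹ * ((K k)ᴴ * K l).trace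

omit [Fintype ι] [DecidableEq ι] [DecidableEq s] [DecidableEq t] in
lemma krausGram_isHermitian (K : ι → Matrix t s ℂ) : (krausGram K).IsHermitian := by
  ext k l
  simp [krausGram, ← Matrix.trace_conjTranspose]

lemma mapEntropy_krausMap (K : ι → Matrix t s ℂ) :
    mapEntropy (krausMap K) = vonNeumannEntropy (krausGram K) := by
  -- The rows of `B` are the conjugated vectorised Kraus operators: up to normalisation, `Bᴴ * B` is
  -- the Choi state and `B * Bᴴ` the Gram matrix.
  set B : Matrix ι (s × t) ℂ := Matrix.of fun k p => star (K k p.2 p.1)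
  set c : ℂ := (Fintype.card s : ℂ)⁻¹
  have hc : star c = c := by simp [c]
  have h1 : choiState (krausMap K) = (c • Bᴴ) * B := by
    ext p q
    simp [choiState, krausMap, B, c, Matrix.mul_apply, Matrix.sum_apply, Matrix.single_apply,
      Finset.mul_sum, ite_and, mul_assoc]
  have h2 : krausGram K = B * (c • Bᴴ) := by
    ext k l
    simp only [krausGram, B, Matrix.of_apply, Matrix.mul_apply, Matrix.trace, Matrix.diag_apply,
      Fintype.sum_prod_type, Matrix.smul_apply, Matrix.conjTranspose_apply, star_star, smul_eq_mul,
      Finset.mul_sum]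
    exact Finset.sum_congr rfl fun i _ => Finset.sum_congr rfl fun j _ => by ring
  have h3 : ((c • Bᴴ) * B).IsHermitian := by
    rw [Matrix.IsHermitian, Matrix.conjTranspose_mul, Matrix.conjTranspose_smul, hc,
      Matrix.conjTranspose_conjTranspose, Matrix.mul_smul, Matrix.smul_mul]
  rw [mapEntropy, h1, vonNeumannEntropy_mul_comm _ _ h3 (h2 ▸ krausGram_isHermitian K), ← h2]

end Kraus

/-! ### Kraus operators of a dilation, local rotations, outcome probabilities -/

section Dilation

variable {s e : Type*} [Fintype s] [DecidableEq s] [Fintype e] [DecidableEq e]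

lemma jointEvolution_apply (e₀ : e) (U : Matrix.unitaryGroup (s × e) ℂ) (ρ : Matrix s s ℂ)
    (p q : s × e) : jointEvolution e₀ U ρ p q =
      ∑ j, (∑ i, U.1 p (i, e₀) * ρ i j) * star (U.1 q (j, e₀)) := by
  simp [jointEvolution, Matrix.mul_apply, Fintype.sum_prod_type, Matrix.kroneckerMap_apply,
    Matrix.single_apply, ite_and]

/-- The Kraus operators `⟨k| U |e₀⟩` of a channel. -/
noncomputable def channelKraus (e₀ : e) (U : Matrix (s × e) (s × e) ℂ) (k : e) : Matrix s s ℂ :=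
  Matrix.of fun i m => U (i, k) (m, e₀)

/-- The Kraus operators of a complementary channel. -/
noncomputable def complementaryKraus (e₀ : e) (U : Matrix (s × e) (s × e) ℂ) (i : s) : Matrix e s ℂ :=
  Matrix.of fun k m => U (i, k) (m, e₀)

lemma channel_eq_krausMap (e₀ : e) (U : Matrix.unitaryGroup (s × e) ℂ) :
    channel e₀ U = krausMap (channelKraus e₀ U.1) := by
  ext1 ρ
  ext i j
  simp only [channel, LinearMap.comp_apply, traceEnv, LinearMap.coe_mk, AddHom.coe_mk,
    Matrix.of_apply, jointEvolution_apply, krausMap, Matrix.sum_apply]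
  simp [Matrix.mul_apply, channelKraus]

lemma complementaryChannel_eq_krausMap (e₀ : e) (U : Matrix.unitaryGroup (s × e) ℂ) :
    complementaryChannel e₀ U = krausMap (complementaryKraus e₀ U.1) := by
  ext1 ρ
  ext i j
  simp only [complementaryChannel, LinearMap.comp_apply, traceSys, LinearMap.coe_mk, AddHom.coe_mk,
    Matrix.of_apply, jointEvolution_apply, krausMap, Matrix.sum_apply]
  simp [Matrix.mul_apply, complementaryKraus]

lemma unitary_sum_col (U : Matrix.unitaryGroup (s × e) ℂ) (q : s × e) :
    ∑ i, ∑ k, star (U.1 (i, k) q) * U.1 (i, k) q = 1 := by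
  have h := congrFun (congrFun (Matrix.UnitaryGroup.star_mul_self U) q) q
  rw [Matrix.mul_apply, Fintype.sum_prod_type] at h
  simpa [Matrix.star_apply] using h

lemma unitary_sum_row (U : Matrix.unitaryGroup (s × e) ℂ) (p : s × e) :
    ∑ q, ‖U.1 p q‖ ^ 2 = 1 := by
  have h := congrFun (congrFun (Unitary.coe_mul_star_self U) p) p
  have h' : ∑ q, U.1 p q * star (U.1 p q) = 1 := by simpa [Matrix.mul_apply] using h
  simp only [RCLike.star_def, Complex.mul_conj, Complex.normSq_eq_norm_sq] at h'
  exact_mod_cast h'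

lemma trace_krausGram_channelKraus [Nonempty s] (e₀ : e) (U : Matrix.unitaryGroup (s × e) ℂ) :
    (krausGram (channelKraus e₀ U.1)).trace = 1 := by
  simp only [Matrix.trace, Matrix.diag_apply, krausGram, channelKraus, Matrix.of_apply,
    Matrix.mul_apply, Matrix.conjTranspose_apply, ← Finset.mul_sum]
  rw [Finset.sum_comm, Finset.sum_congr rfl fun m _ =>
    Finset.sum_comm.trans (unitary_sum_col U (m, e₀))]
  simp

lemma trace_krausGram_complementaryKraus [Nonempty s] (e₀ : e)
    (U : Matrix.unitaryGroup (s × e) ℂ) :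
    (krausGram (complementaryKraus e₀ U.1)).trace = 1 := by
  simp only [Matrix.trace, Matrix.diag_apply, krausGram, complementaryKraus, Matrix.of_apply,
    Matrix.mul_apply, Matrix.conjTranspose_apply, ← Finset.mul_sum]
  rw [Finset.sum_comm, Finset.sum_congr rfl fun m _ => unitary_sum_col U (m, e₀)]
  simp

/-- The joint evolution followed by local basis changes `P` of the system and `Q` of the
environment. -/
noncomputable def localRotation (P : Matrix.unitaryGroup s ℂ) (Q : Matrix.unitaryGroup e ℂ)
    (U : Matrix.unitaryGroup (s × e) ℂ) : Matrix.unitaryGroup (s × e) ℂ :=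
  -- With the transpose, coefficient matrices become `Pᵀ * A * Q`, so the two Gram matrices are
  -- conjugated by `Q` and `P` themselves, with no complex conjugates.
  ⟨(P.1 ⊗ₖ Q.1)ᵀ * U.1, mul_mem (by
    have h := Matrix.mem_unitaryGroup_iff'.mp (Matrix.kronecker_mem_unitary P.2 Q.2)
    rw [Matrix.mem_unitaryGroup_iff, Matrix.star_eq_conjTranspose]
    change _ * ((P.1 ⊗ₖ Q.1)ᴴ)ᵀ = 1
    rw [← Matrix.transpose_mul, ← Matrix.star_eq_conjTranspose, h, Matrix.transpose_one]) U.2⟩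

/-- The coefficient matrix of `U (|m⟩ ⊗ |e₀⟩)` in the product basis. -/
def outputCoeff (e₀ : e) (U : Matrix (s × e) (s × e) ℂ) (m : s) : Matrix s e ℂ :=
  Matrix.of fun i k => U (i, k) (m, e₀)

lemma outputCoeff_localRotation (e₀ : e) (P : Matrix.unitaryGroup s ℂ)
    (Q : Matrix.unitaryGroup e ℂ) (U : Matrix.unitaryGroup (s × e) ℂ) (m : s) :
    outputCoeff e₀ (localRotation P Q U).1 m = P.1ᵀ * outputCoeff e₀ U.1 m * Q.1 := by
  ext i k
  simp only [outputCoeff, localRotation, Matrix.of_apply, Matrix.mul_apply, Fintype.sum_prod_type,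
    Matrix.transpose_apply, Matrix.kroneckerMap_apply, Finset.sum_mul]
  rw [Finset.sum_comm]
  exact Finset.sum_congr rfl fun _ _ => Finset.sum_congr rfl fun _ _ => by ring

omit [DecidableEq s] [Fintype e] [DecidableEq e] in
lemma krausGram_channelKraus (e₀ : e) (U : Matrix (s × e) (s × e) ℂ) :
    krausGram (channelKraus e₀ U) =
      (Fintype.card s : ℂ)⁻¹ • ∑ m, (outputCoeff e₀ U m)ᴴ * outputCoeff e₀ U m := by
  ext k l
  simp [krausGram, channelKraus, outputCoeff, Matrix.trace, Matrix.mul_apply, Matrix.sum_apply]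

omit [DecidableEq s] [DecidableEq e] in
lemma krausGram_complementaryKraus (e₀ : e) (U : Matrix (s × e) (s × e) ℂ) :
    krausGram (complementaryKraus e₀ U) =
      (Fintype.card s : ℂ)⁻¹ • ∑ m, (outputCoeff e₀ U m)ᵀᴴ * (outputCoeff e₀ U m)ᵀ := by
  ext k l
  simp [krausGram, complementaryKraus, outputCoeff, Matrix.trace, Matrix.mul_apply,
    Matrix.sum_apply]

omit [Fintype e] [DecidableEq e] in
lemma conjTranspose_mul_self_of_unitary_left (P : Matrix.unitaryGroup s ℂ) (A : Matrix s e ℂ) :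
    (P.1ᵀ * A)ᴴ * (P.1ᵀ * A) = Aᴴ * A := by
  have h : P.1ᵀᴴ * P.1ᵀ = 1 := by
    change (P.1ᴴ)ᵀ * P.1ᵀ = 1
    rw [← Matrix.transpose_mul, ← Matrix.star_eq_conjTranspose, Matrix.mem_unitaryGroup_iff.mp P.2,
      Matrix.transpose_one]
  rw [Matrix.conjTranspose_mul, Matrix.mul_assoc, ← Matrix.mul_assoc _ _ A, h, Matrix.one_mul]

lemma krausGram_channelKraus_localRotation (e₀ : e) (P : Matrix.unitaryGroup s ℂ)
    (Q : Matrix.unitaryGroup e ℂ) (U : Matrix.unitaryGroup (s × e) ℂ) :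
    krausGram (channelKraus e₀ (localRotation P Q U).1) =
      star Q.1 * krausGram (channelKraus e₀ U.1) * Q.1 := by
  rw [krausGram_channelKraus, krausGram_channelKraus]
  simp only [outputCoeff_localRotation, Matrix.mul_smul, Matrix.smul_mul, Matrix.mul_sum,
    Matrix.sum_mul]
  congr 1
  refine Finset.sum_congr rfl fun m _ => ?_
  rw [Matrix.conjTranspose_mul, Matrix.mul_assoc, ← Matrix.mul_assoc _ _ Q.1,
    conjTranspose_mul_self_of_unitary_left P,
    Matrix.star_eq_conjTranspose]
  simp only [Matrix.mul_assoc]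

lemma krausGram_complementaryKraus_localRotation (e₀ : e) (P : Matrix.unitaryGroup s ℂ)
    (Q : Matrix.unitaryGroup e ℂ) (U : Matrix.unitaryGroup (s × e) ℂ) :
    krausGram (complementaryKraus e₀ (localRotation P Q U).1) =
      star P.1 * krausGram (complementaryKraus e₀ U.1) * P.1 := by
  rw [krausGram_complementaryKraus, krausGram_complementaryKraus]
  simp only [outputCoeff_localRotation, Matrix.mul_smul, Matrix.smul_mul, Matrix.mul_sum,
    Matrix.sum_mul]
  congr 1
  refine Finset.sum_congr rfl fun m _ => ?_
  rw [Matrix.transpose_mul, Matrix.transpose_mul, Matrix.transpose_transpose,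
    conjTranspose_mul_self_of_unitary_left Q, Matrix.conjTranspose_mul,
    Matrix.star_eq_conjTranspose]
  simp only [Matrix.mul_assoc]

/-- The probability of the product outcome `(i, k)` after the evolution of the maximally mixed
state. -/
noncomputable def outcomeProb (e₀ : e) (U : Matrix (s × e) (s × e) ℂ) (i : s) (k : e) : ℝ :=
  (Fintype.card s : ℝ)⁻¹ * ∑ m, ‖U (i, k) (m, e₀)‖ ^ 2

omit [DecidableEq s] [Fintype e] [DecidableEq e] in
lemma outcomeProb_nonneg (e₀ : e) (U : Matrix (s × e) (s × e) ℂ) (i : s) (k : e) :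
    0 ≤ outcomeProb e₀ U i k := by
  unfold outcomeProb; positivity

/-- The sum runs over part of a row of a unitary matrix, and such a row has norm one. -/
lemma outcomeProb_le (e₀ : e) (U : Matrix.unitaryGroup (s × e) ℂ) (i : s) (k : e) :
    outcomeProb e₀ U.1 i k ≤ (Fintype.card s : ℝ)⁻¹ := by
  refine mul_le_of_le_one_right (by positivity) ?_
  rw [← unitary_sum_row U (i, k), Fintype.sum_prod_type]
  exact Finset.sum_le_sum fun m _ =>
    Finset.single_le_sum (f := fun l => ‖U.1 (i, k) (m, l)‖ ^ 2) (fun _ _ => by positivity)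
      (Finset.mem_univ e₀)

omit [DecidableEq s] [Fintype e] [DecidableEq e] in
lemma krausGram_channelKraus_diag (e₀ : e) (U : Matrix (s × e) (s × e) ℂ) (k : e) :
    krausGram (channelKraus e₀ U) k k = (∑ i, outcomeProb e₀ U i k : ℝ) := by
  simp [krausGram, channelKraus, outcomeProb, Matrix.trace, Matrix.mul_apply, Complex.conj_mul',
    ← Finset.mul_sum]
  exact Or.inl Finset.sum_comm

omit [DecidableEq s] [DecidableEq e] in
lemma krausGram_complementaryKraus_diag (e₀ : e) (U : Matrix (s × e) (s × e) ℂ) (i : s) :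
    krausGram (complementaryKraus e₀ U) i i = (∑ k, outcomeProb e₀ U i k : ℝ) := by
  simp [krausGram, complementaryKraus, outcomeProb, Matrix.trace, Matrix.mul_apply,
    Complex.conj_mul', ← Finset.mul_sum]
  exact Or.inl Finset.sum_comm

end Dilation

lemma star_eigenvectorUnitary_mul_mul_apply {n : Type*} [Fintype n] [DecidableEq n]
    {A : Matrix n n ℂ} (hA : A.IsHermitian) (i : n) :
    (star hA.eigenvectorUnitary.1 * A * hA.eigenvectorUnitary.1) i i = hA.eigenvalues i := by
  have h := hA.conjStarAlgAut_star_eigenvectorUnitary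
  rw [Unitary.conjStarAlgAut_apply] at h
  simpa using congrFun (congrFun h i) i

/-! ### The bound for qubits and its attainment -/

section QubitChannel

lemma exists_weights (U : Matrix.unitaryGroup (Fin 2 × Fin 2) ℂ) :
    ∃ w : Fin 2 → Fin 2 → ℝ, (∀ i k, 0 ≤ w i k ∧ w i k ≤ 1 / 2) ∧
      w 0 0 + w 0 1 + w 1 0 + w 1 1 = 1 ∧
      mapEntropy (channel 0 U) = Real.binEntropy (w 0 0 + w 1 0) ∧
      mapEntropy (complementaryChannel 0 U) = Real.binEntropy (w 0 0 + w 0 1) := by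
  have hE := krausGram_isHermitian (channelKraus 0 U.1)
  have hS := krausGram_isHermitian (complementaryKraus 0 U.1)
  -- In the eigenbases of both Gram matrices, the diagonals, hence the marginals of `outcomeProb`,
  -- are the eigenvalues.
  set V := localRotation hS.eigenvectorUnitary hE.eigenvectorUnitary U
  have hwE (k : Fin 2) : hE.eigenvalues k = ∑ i, outcomeProb 0 V.1 i k := by
    have h := star_eigenvectorUnitary_mul_mul_apply hE k
    rw [← krausGram_channelKraus_localRotation 0 hS.eigenvectorUnitary,
      krausGram_channelKraus_diag] at h
    exact_mod_cast h.symm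
  have hwS (i : Fin 2) : hS.eigenvalues i = ∑ k, outcomeProb 0 V.1 i k := by
    have h := star_eigenvectorUnitary_mul_mul_apply hS i
    rw [← krausGram_complementaryKraus_localRotation 0 _ hE.eigenvectorUnitary,
      krausGram_complementaryKraus_diag] at h
    exact_mod_cast h.symm
  have hsum := sum_eigenvalues_eq_one hE (trace_krausGram_channelKraus 0 U)
  refine ⟨outcomeProb 0 V.1, fun i k => ⟨outcomeProb_nonneg _ _ _ _, ?_⟩, ?_, ?_, ?_⟩
  · simpa using outcomeProb_le 0 V i k
  · simp only [hwE, Fin.sum_univ_two] at hsum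
    linarith
  · rw [channel_eq_krausMap, mapEntropy_krausMap,
      vonNeumannEntropy_eq_binEntropy hE (trace_krausGram_channelKraus 0 U), hwE, Fin.sum_univ_two]
  · rw [complementaryChannel_eq_krausMap, mapEntropy_krausMap,
      vonNeumannEntropy_eq_binEntropy hS (trace_krausGram_complementaryKraus 0 U), hwS,
      Fin.sum_univ_two]

lemma binEntropy_min (p : ℝ) : Real.binEntropy (min p (1 - p)) = Real.binEntropy p := by
  rcases min_choice p (1 - p) with h | h <;> simp [h]

lemma exists_curve_le {p : ℝ × ℝ} (hp : p ∈ allowedRegion 2) :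
    ∃ a ∈ Set.Icc (0 : ℝ) (1 / 2),
      p.1 = Real.binEntropy a ∧ Real.binEntropy (1 / 2 - a) ≤ p.2 := by
  obtain ⟨U, rfl⟩ := hp
  obtain ⟨w, hw, hsum, h1, h2⟩ := exists_weights U
  have h00 := hw 0 0
  have h01 := hw 0 1
  have h10 := hw 1 0
  have h11 := hw 1 1
  set α := w 0 0 + w 1 0
  set β := w 0 0 + w 0 1
  have hα : 0 ≤ α ∧ α ≤ 1 := ⟨by simp only [α]; linarith, by simp only [α]; linarith⟩
  refine ⟨min α (1 - α), ⟨le_min hα.1 (by linarith), ?_⟩, ?_, ?_⟩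
  · rcases le_total α (1 - α) with h | h
    · rw [min_eq_left h]; linarith
    · rw [min_eq_right h]; linarith
  · rw [binEntropy_min]; exact h1
  · simp only [h2]
    rw [← binEntropy_min β]
    -- Each choice of minima picks a row and a column of the table. Their sums add up to 1 plus the
    -- entry in both minus the entry in neither, hence to at least 1/2.
    have key : 1 / 2 - min α (1 - α) ≤ min β (1 - β) ∧ 0 ≤ 1 / 2 - min α (1 - α) ∧
        min β (1 - β) ≤ 2⁻¹ := by
      rcases min_cases α (1 - α) with h | h <;> rcases min_cases β (1 - β) with h' | h' <;>
      rw [h.1, h'.1] <;> simp only [α, β] at * <;> refine ⟨?_, ?_, ?_⟩ <;> linarith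
    exact Real.binEntropy_strictMonoOn.monotoneOn ⟨key.2.1, key.1.trans key.2.2⟩
      ⟨key.2.1.trans key.1, key.2.2⟩ key.1

lemma amplitudeDamping_entropy {a : ℝ} (ha : a ∈ Set.Icc (0 : ℝ) (1 / 2)) :
    mapEntropy (amplitudeDamping (1 - 2 * a)) = Real.binEntropy a := by
  have h1 : ((Real.sqrt (1 - 2 * a) : ℂ)) ^ 2 = 1 - 2 * a := by
    rw [← Complex.ofReal_pow, Real.sq_sqrt (by linarith [ha.2])]; push_cast; ring
  have h2 : ((Real.sqrt (1 - (1 - 2 * a)) : ℂ)) ^ 2 = 2 * a := by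
    rw [← Complex.ofReal_pow, Real.sq_sqrt (by linarith [ha.1])]; push_cast; ring
  have hG : krausGram (amplitudeDampingKraus (1 - 2 * a)) = !![1 - (a : ℂ), 0; 0, (a : ℂ)] := by
    unfold amplitudeDampingKraus
    generalize Real.sqrt (1 - 2 * a) = c at *
    generalize Real.sqrt (1 - (1 - 2 * a)) = d at *
    ext k l
    fin_cases k <;> fin_cases l <;>
    simp [krausGram, Matrix.trace, Matrix.mul_apply, Fin.sum_univ_two, ← pow_two, h1, h2]
    ring
  rw [amplitudeDamping, mapEntropy_krausMap,
    vonNeumannEntropy_eq_of_det (p := a) (krausGram_isHermitian _)]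
  · simp [hG]
  · rw [hG, Matrix.det_fin_two_of]; ring

/-- Shows that the complementary entropy depends on the channel alone, so it is the same for every
dilation `U`. -/
lemma krausGram_complementaryKraus_eq_channel {s e : Type*} [Fintype s] [DecidableEq s] [Fintype e]
    [DecidableEq e] (e₀ : e) (U : Matrix.unitaryGroup (s × e) ℂ) :
    krausGram (complementaryKraus e₀ U.1) =
      (Fintype.card s : ℂ)⁻¹ • (channel e₀ U 1)ᵀ := by
  ext i j
  rw [channel_eq_krausMap]
  simp only [krausGram, krausMap, complementaryKraus, channelKraus, Matrix.trace,
    Matrix.of_apply, Matrix.diag_apply, Matrix.mul_apply, Matrix.conjTranspose_apply,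
    Matrix.smul_apply, Matrix.transpose_apply, LinearMap.coe_mk, AddHom.coe_mk, Matrix.sum_apply,
    mul_one, smul_eq_mul]
  rw [Finset.sum_comm]
  exact congrArg _ (Finset.sum_congr rfl fun _ _ => Finset.sum_congr rfl fun _ _ => mul_comm _ _)

lemma complementary_entropy_of_amplitudeDamping {a : ℝ} (ha : a ∈ Set.Icc (0 : ℝ) (1 / 2))
    {U : Matrix.unitaryGroup (Fin 2 × Fin 2) ℂ} (hU : channel 0 U = amplitudeDamping (1 - 2 * a)) :
    mapEntropy (complementaryChannel 0 U) = Real.binEntropy (1 / 2 - a) := by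
  have h1 : ((Real.sqrt (1 - 2 * a) : ℂ)) ^ 2 = 1 - 2 * a := by
    rw [← Complex.ofReal_pow, Real.sq_sqrt (by linarith [ha.2])]; push_cast; ring
  have h2 : ((Real.sqrt (1 - (1 - 2 * a)) : ℂ)) ^ 2 = 2 * a := by
    rw [← Complex.ofReal_pow, Real.sq_sqrt (by linarith [ha.1])]; push_cast; ring
  have hG : krausGram (complementaryKraus 0 U.1) =
      !![1 / 2 + (a : ℂ), 0; 0, 1 / 2 - (a : ℂ)] := by
    rw [krausGram_complementaryKraus_eq_channel, hU]
    unfold amplitudeDamping amplitudeDampingKraus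
    generalize Real.sqrt (1 - 2 * a) = c at *
    generalize Real.sqrt (1 - (1 - 2 * a)) = d at *
    ext k l
    fin_cases k <;> fin_cases l <;>
    simp [krausMap, Matrix.vecMul_eq_sum, Fin.sum_univ_two, ← pow_two, h1, h2] <;> ring
  rw [complementaryChannel_eq_krausMap, mapEntropy_krausMap,
    vonNeumannEntropy_eq_of_det (p := 1 / 2 - a) (krausGram_isHermitian _)
      (trace_krausGram_complementaryKraus 0 U)]
  rw [hG, Matrix.det_fin_two_of]; push_cast; ring

/-- A unitary dilation of the amplitude damping channel, in the basis `00, 01, 10, 11`. -/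
noncomputable def amplitudeDampingDilation (x : ℝ) : Matrix (Fin 4) (Fin 4) ℂ :=
  !![1, 0, 0, 0; 0, -(Real.sqrt x : ℂ), (Real.sqrt (1 - x) : ℂ), 0;
    0, (Real.sqrt (1 - x) : ℂ), (Real.sqrt x : ℂ), 0; 0, 0, 0, 1]

lemma amplitudeDampingDilation_mul_conjTranspose {x : ℝ} (h0 : 0 ≤ x) (h1 : x ≤ 1) :
    amplitudeDampingDilation x * (amplitudeDampingDilation x)ᴴ = 1 := by
  have hx : (Real.sqrt x : ℂ) * Real.sqrt x = x := by
    rw [← Complex.ofReal_mul, Real.mul_self_sqrt h0]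
  have hy : (Real.sqrt (1 - x) : ℂ) * Real.sqrt (1 - x) = 1 - x := by
    rw [← Complex.ofReal_mul, Real.mul_self_sqrt (by linarith)]; push_cast; ring
  unfold amplitudeDampingDilation
  generalize Real.sqrt x = c at *
  generalize Real.sqrt (1 - x) = d at *
  ext i j
  fin_cases i <;> fin_cases j <;>
  simp [Matrix.mul_apply, Fin.sum_univ_four, hx, hy, mul_comm]

lemma exists_channel_eq_amplitudeDamping {x : ℝ} (h0 : 0 ≤ x) (h1 : x ≤ 1) :
    ∃ U : Matrix.unitaryGroup (Fin 2 × Fin 2) ℂ, channel 0 U = amplitudeDamping x := by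
  -- Only the columns of the inputs `00` and `10` enter the channel; the other two just complete the
  -- matrix to a unitary.
  refine ⟨⟨(amplitudeDampingDilation x).submatrix finProdFinEquiv finProdFinEquiv, ?_⟩, ?_⟩
  · rw [Matrix.mem_unitaryGroup_iff, Matrix.star_eq_conjTranspose, Matrix.conjTranspose_submatrix,
      Matrix.submatrix_mul_equiv, amplitudeDampingDilation_mul_conjTranspose h0 h1,
      Matrix.submatrix_one_equiv]
  · rw [channel_eq_krausMap, amplitudeDamping]
    congr 1
    ext k i m
    fin_cases k <;> fin_cases i <;> fin_cases m <;>
    simp [channelKraus, amplitudeDampingDilation, amplitudeDampingKraus, finProdFinEquiv]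

lemma isLeast_curve {a : ℝ} (ha : a ∈ Set.Icc (0 : ℝ) (1 / 2)) :
    IsLeast {t : ℝ | (Real.binEntropy a, t) ∈ allowedRegion 2} (Real.binEntropy (1 / 2 - a)) := by
  constructor
  · obtain ⟨U, hU⟩ := exists_channel_eq_amplitudeDamping (x := 1 - 2 * a) (by linarith [ha.2])
      (by linarith [ha.1])
    refine ⟨U, ?_⟩
    simp only
    rw [complementary_entropy_of_amplitudeDamping ha hU, hU, amplitudeDamping_entropy ha]
  · intro t ht
    obtain ⟨b, hb, hab, hbt⟩ := exists_curve_le ht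
    -- The monotonicity of `Real.binEntropy` is stated on `[0, 2⁻¹]`; injectivity there forces `b =
    -- a`.
    rw [one_div] at ha hb
    rwa [Real.binEntropy_strictMonoOn.injOn ha hb hab]

end QubitChannel

end ChannelEntropy

theorem proposition2 :
    -- the lower boundary is the curve
    lowerBoundary (allowedRegion 2) =
        (fun a : ℝ => (Real.binEntropy a, Real.binEntropy (1 / 2 - a))) '' Set.Icc 0 (1 / 2) ∧
    -- at every channel entropy on the curve, the minimum is attained and given by the curve
    (∀ a ∈ Set.Icc (0 : ℝ) (1 / 2),
      IsLeast {t : ℝ | (Real.binEntropy a, t) ∈ allowedRegion 2} (Real.binEntropy (1 / 2 - a))) ∧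
    -- every allowed point lies on or above the curve
    (∀ p ∈ allowedRegion 2, ∃ a ∈ Set.Icc (0 : ℝ) (1 / 2),
      p.1 = Real.binEntropy a ∧ Real.binEntropy (1 / 2 - a) ≤ p.2) ∧
    -- amplitude damping channels have a qubit environment and trace out the curve
    (∀ a ∈ Set.Icc (0 : ℝ) (1 / 2),
      (∃ U : Matrix.unitaryGroup (Fin 2 × Fin 2) ℂ,
        channel 0 U = amplitudeDamping (1 - 2 * a)) ∧
      ∀ U : Matrix.unitaryGroup (Fin 2 × Fin 2) ℂ,
        channel 0 U = amplitudeDamping (1 - 2 * a) →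
          mapEntropy (channel 0 U) = Real.binEntropy a ∧
          mapEntropy (complementaryChannel 0 U) = Real.binEntropy (1 / 2 - a)) := by
  have hleast := fun a ha => isLeast_curve (a := a) ha
  refine ⟨Set.ext fun p => ⟨fun hp => ?_, ?_⟩, hleast, fun p hp => exists_curve_le hp,
    fun a ha => ⟨exists_channel_eq_amplitudeDamping (by linarith [ha.2]) (by linarith [ha.1]),
      fun U hU => ⟨by rw [hU, amplitudeDamping_entropy ha],
        complementary_entropy_of_amplitudeDamping ha hU⟩⟩⟩
  · obtain ⟨a, ha, h1, -⟩ := exists_curve_le hp.1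
    refine ⟨a, ha, Prod.ext h1.symm ((hleast a ha).unique ?_)⟩
    rw [← h1]
    exact hp
  · rintro ⟨a, ha, rfl⟩
    exact hleast a ha
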